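/- **Proposition.** Let $\mathcal H,\mathcal Z$ be complex Hilbert spaces (not necessarily separable) with $\mathcal Z\neq\{0\}$. Write $\mathcal B^1(\cdot)$ for the trace class with the trace norm, $\mathcal B(\mathcal B^1(\mathcal H),\mathcal B^1(\mathcal Z))$ for the bounded linear maps between the trace classes, $\mathcal H\otimes\mathcal Z$ for the Hilbert space tensor product, and $|x\rangle\langle y|$ for the operator $z\mapsto\langle y,z\rangle x$. For an orthonormal basis $G=\{g_j\}_{j\in J}$ of $\mathcal H$ and $\lambda\in\ell^1(J,\mathbb C)$ consider the weighted Choi map $$\mathsf C_{\lambda,G}:\mathcal B(\mathcal B^1(\mathcal H),\mathcal B^1(\mathcal Z))\to\mathcal B^1(\mathcal H\otimes\mathcal Z),\qquad \Phi\mapsto\sum_{j,k\in J}\overline{\lambda_j}\,\lambda_k\,|g_j\rangle\langle g_k|\otimes\Phi(|g_j\rangle\langle g_k|).$$ For every orthonormal basis $G=\{g_j\}_{j\in J}$ of $\mathcal H$ and every $\lambda\in\ell^1(J,\mathbb C)$, the map $\mathsf C_{\lambda,G}$ is well defined (for every $\Phi$ the family is summable, as an unordered sum, in trace norm), and (i)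 $\mathsf C_{\lambda,G}$ is injective if and only if $\mathcal H$ is separable and $\lambda_j\neq0$ for all $j\in J$; (ii) $\mathsf C_{\lambda,G}$ is surjective if and only if $\mathcal H$ is finite-dimensional and $\lambda_j\neq0$ for all $j\in J$. Moreover, if $\dim\mathcal H=\infty$, then there exists a positive semi-definite trace-class operator $Y$ on $\mathcal H\otimes\mathcal Z$ such that $\mathsf C_{\lambda,G}^{-1}(\{Y\})=\emptyset$ for every orthonormal basis $G=\{g_j\}_{j\in J}$ of $\mathcal H$ and every $\lambda\in\ell^1(J,\mathbb C)$. -/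

import Mathlib

open scoped InnerProductSpace TensorProduct
open InnerProductSpace

/-- `X = ∑_{j ∈ N} s_j |f_j⟩⟨g_j|` in operator norm, with orthonormal systems `f`, `g` and `s_j > 0`.
The order of the singular values `s_j` is irrelevant below, so none is imposed. -/
structure IsSchmidtDecomposition {H : Type*} [NormedAddCommGroup H] [InnerProductSpace ℂ H]
    (X : H →L[ℂ] H) (N : Set ℕ) (s : N → ℝ) (f g : N → H) : Prop where
  orthonormal_left : Orthonormal ℂ f
  orthonormal_right : Orthonormal ℂ g
  pos : ∀ j, 0 < s j
  hasSum : HasSum (fun j => (s j : ℂ) • rankOne ℂ (f j) (g j)) X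

/-- `X` is trace class: it has a Schmidt decomposition with summable singular values. -/
def IsTraceClass {H : Type*} [NormedAddCommGroup H] [InnerProductSpace ℂ H]
    (X : H →L[ℂ] H) : Prop :=
  ∃ (N : Set ℕ) (s : N → ℝ) (f g : N → H), IsSchmidtDecomposition X N s f g ∧ Summable s

/-- The trace norm, the sum of the singular values. All Schmidt decompositions of a trace-class
operator give the same sum, see `IsSchmidtDecomposition.traceNorm_eq`. -/
noncomputable def traceNorm {H : Type*} [NormedAddCommGroup H] [InnerProductSpace ℂ H]
    (X : H →L[ℂ] H) : ℝ :=
  sInf {r : ℝ | ∃ (N : Set ℕ) (s : N → ℝ) (f g : N → H),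
    IsSchmidtDecomposition X N s f g ∧ HasSum s r}

section Nuclear

universe u

variable {H : Type u} [NormedAddCommGroup H] [InnerProductSpace ℂ H]

theorem nuclear_inner_bound {ι κ : Type*} {T : H →L[ℂ] H} {x y : ι → H} {f g : κ → H}
    (hT : HasSum (fun i => rankOne ℂ (x i) (y i)) T)
    (hs : Summable fun i => ‖x i‖ * ‖y i‖) (hf : Orthonormal ℂ f) (hg : Orthonormal ℂ g)
    (F : Finset κ) :
    ∑ j ∈ F, ‖⟪f j, T (g j)⟫_ℂ‖ ≤ ∑' i, ‖x i‖ * ‖y i‖ := by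
  have hb : ∀ i, ∑ j ∈ F, ‖⟪f j, x i⟫_ℂ‖ * ‖⟪g j, y i⟫_ℂ‖ ≤ ‖x i‖ * ‖y i‖ := by
    intro i
    refine (Real.sum_mul_le_sqrt_mul_sqrt _ _ _).trans ?_
    gcongr
    · exact Real.sqrt_le_iff.2 ⟨norm_nonneg _, hf.sum_inner_products_le _⟩
    · exact Real.sqrt_le_iff.2 ⟨norm_nonneg _, hg.sum_inner_products_le _⟩
  have hsj : ∀ j ∈ F, Summable fun i => ‖⟪f j, x i⟫_ℂ‖ * ‖⟪g j, y i⟫_ℂ‖ := fun j hj =>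
    Summable.of_nonneg_of_le (fun i => by positivity)
      (fun i => (Finset.single_le_sum (f := fun j => ‖⟪f j, x i⟫_ℂ‖ * ‖⟪g j, y i⟫_ℂ‖)
        (fun j _ => by positivity) hj).trans (hb i)) hs
  have hj : ∀ j ∈ F, ‖⟪f j, T (g j)⟫_ℂ‖ ≤ ∑' i, ‖⟪f j, x i⟫_ℂ‖ * ‖⟪g j, y i⟫_ℂ‖ := by
    intro j hj
    have h1 : HasSum (fun i => ⟪y i, g j⟫_ℂ * ⟪f j, x i⟫_ℂ) ⟪f j, T (g j)⟫_ℂ := by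
      have := (hT.mapL (ContinuousLinearMap.apply ℂ H (g j))).mapL (innerSL ℂ (f j))
      simpa [inner_smul_right] using this
    have h2 : ∀ i, ‖⟪y i, g j⟫_ℂ * ⟪f j, x i⟫_ℂ‖ = ‖⟪f j, x i⟫_ℂ‖ * ‖⟪g j, y i⟫_ℂ‖ := by
      intro i; rw [norm_mul, mul_comm, norm_inner_symm (y i)]
    rw [← h1.tsum_eq, ← tsum_congr h2]
    exact norm_tsum_le_tsum_norm ((hsj j hj).congr fun i => (h2 i).symm)
  calc _ ≤ ∑ j ∈ F, ∑' i, ‖⟪f j, x i⟫_ℂ‖ * ‖⟪g j, y i⟫_ℂ‖ := Finset.sum_le_sum hj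
    _ = ∑' i, ∑ j ∈ F, ‖⟪f j, x i⟫_ℂ‖ * ‖⟪g j, y i⟫_ℂ‖ := (Summable.tsum_finsetSum hsj).symm
    _ ≤ _ := (summable_sum hsj).tsum_le_tsum hb hs

theorem IsSchmidtDecomposition.inner_apply {X : H →L[ℂ] H} {N : Set ℕ} {s : N → ℝ} {f g : N → H}
    (h : IsSchmidtDecomposition X N s f g) (j : N) : ⟪f j, X (g j)⟫_ℂ = s j := by
  classical
  have h1 := (h.hasSum.mapL (ContinuousLinearMap.apply ℂ H (g j))).mapL (innerSL ℂ (f j))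
  have h2 : HasSum (fun i => if i = j then (s j : ℂ) else 0) (s j : ℂ) := hasSum_ite_eq j _
  refine h1.unique (h2.congr_fun ?_) 
  intro i
  by_cases hij : i = j
  · subst hij
    simp [h.orthonormal_left.1, h.orthonormal_right.1]
  · simp [h.orthonormal_right.2 hij, hij]

theorem nuclear_schmidt_sum_le {ι : Type*} {T : H →L[ℂ] H} {x y : ι → H}
    (hT : HasSum (fun i => rankOne ℂ (x i) (y i)) T) (hs : Summable fun i => ‖x i‖ * ‖y i‖)
    {N : Set ℕ} {s : N → ℝ} {f g : N → H} (h : IsSchmidtDecomposition T N s f g) :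
    Summable s ∧ ∑' j, s j ≤ ∑' i, ‖x i‖ * ‖y i‖ := by
  have hF : ∀ F : Finset N, ∑ j ∈ F, s j ≤ ∑' i, ‖x i‖ * ‖y i‖ := by
    intro F
    refine le_trans (le_of_eq (Finset.sum_congr rfl fun j _ => ?_))
      (nuclear_inner_bound hT hs h.orthonormal_left h.orthonormal_right F)
    rw [h.inner_apply]; simp [abs_of_pos (h.pos j)]
  have h1 := summable_of_sum_le (fun j => (h.pos j).le) hF
  exact ⟨h1, h1.tsum_le_of_sum_le hF⟩

theorem nuclear_isCompact [CompleteSpace H] {ι : Type*} {T : H →L[ℂ] H} {x y : ι → H}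
    (hT : HasSum (fun i => rankOne ℂ (x i) (y i)) T) : IsCompactOperator T := by
  refine isCompactOperator_of_tendsto hT (Filter.Eventually.of_forall fun F => ?_)
  classical
  have h1 : ∀ i, IsCompactOperator (rankOne ℂ (x i) (y i)) := by
    intro i
    have : IsCompactOperator (id : ℂ → ℂ) := isCompactOperator_id_iff_finiteDimensional (𝕜 := ℂ) |>.2 inferInstance
    have h2 : IsCompactOperator (innerSL ℂ (y i)) := this.comp_clm (innerSL ℂ (y i))
    have h3 := h2.clm_comp (ContinuousLinearMap.toSpanSingleton ℂ (x i))
    exact h3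
  exact Submodule.sum_mem (compactOperator (RingHom.id ℂ) H H) (fun i _ => h1 i)

theorem exists_eigenbasis [CompleteSpace H] (T : H →L[ℂ] H) (hT : IsCompactOperator T) :
    ∃ (κ : Type u) (e : HilbertBasis κ ℂ H), ∀ i j, i ≠ j → ⟪T (e i), T (e j)⟫_ℂ = 0 := by
  obtain ⟨S, hS⟩ : ∃ S : H →L[ℂ] H, S = T.adjoint ∘L T := ⟨_, rfl⟩
  have hc : IsCompactOperator S := by rw [hS]; exact hT.clm_comp T.adjoint
  have hsym : (S : H →ₗ[ℂ] H).IsSymmetric := by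
    intro u v
    simp [hS, ContinuousLinearMap.adjoint_inner_left, ContinuousLinearMap.adjoint_inner_right]
  obtain ⟨V, hV⟩ : ∃ V : ℂ → Submodule ℂ H, V = Module.End.eigenspace (S : H →ₗ[ℂ] H) := ⟨_, rfl⟩
  have hmem : ∀ μ v, v ∈ V μ ↔ S v = μ • v := fun μ v => by
    rw [hV]; exact Module.End.mem_eigenspace_iff
  have hbot : (⨆ μ, V μ)ᗮ = ⊥ := by
    rw [hV]; exact ContinuousLinearMap.orthogonalComplement_iSup_eigenspaces_eq_bot hc hsym
  have hfam : OrthogonalFamily ℂ (fun μ => V μ) fun μ => (V μ).subtypeₗᵢ := by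
    subst hV; exact hsym.orthogonalFamily_eigenspaces
  have hcl : ∀ μ : ℂ, CompleteSpace (V μ) := by
    intro μ
    have : IsClosed (V μ : Set H) := by
      have h2 : (V μ : Set H) = {v | S v = μ • v} := by
        ext v; exact hmem μ v
      rw [h2]
      exact isClosed_eq (by fun_prop) (by fun_prop)
    exact this.completeSpace_coe
  clear hV
  choose w b hb using fun μ : ℂ => exists_hilbertBasis ℂ (V μ)
  have ho : Orthonormal ℂ fun a : Σ μ, w μ => ((b a.1 a.2 : V a.1) : H) :=
    hfam.orthonormal_sigma_orthonormal (fun μ => (b μ).orthonormal)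
  have hspan : (Submodule.span ℂ (Set.range fun a : Σ μ, w μ => ((b a.1 a.2 : V a.1) : H)))ᗮ
      = ⊥ := by
    rw [← le_bot_iff, ← hbot]
    intro v hv
    rw [Submodule.mem_orthogonal] at hv
    rw [← Submodule.iInf_orthogonal, Submodule.mem_iInf]
    intro μ
    rw [Submodule.mem_orthogonal]
    intro u hu
    have h4 := (((b μ).hasSum_repr ⟨u, hu⟩).mapL (V μ).subtypeL).mapL (innerSL ℂ v)
    have h5 : ⟪v, u⟫_ℂ = 0 := by
      refine h4.unique (hasSum_zero.congr_fun ?_)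
      intro i
      have h6 := hv _ (Submodule.subset_span ⟨⟨μ, i⟩, rfl⟩)
      have h7 : ⟪v, ((b μ i : V μ) : H)⟫_ℂ = 0 := inner_eq_zero_symm.1 h6
      simp [h7]
    exact inner_eq_zero_symm.1 h5
  refine ⟨_, HilbertBasis.mkOfOrthogonalEqBot ho hspan, ?_⟩
  intro i j hij
  rw [HilbertBasis.coe_mkOfOrthogonalEqBot, ← ContinuousLinearMap.adjoint_inner_right]
  have h8 : T.adjoint (T (b j.1 j.2 : V j.1)) = j.1 • ((b j.1 j.2 : V j.1) : H) := by
    have := (hmem j.1 _).1 (b j.1 j.2).2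
    rwa [hS] at this
  rw [h8, inner_smul_right, ho.2 hij, mul_zero]

theorem exists_compact_svd [CompleteSpace H] (T : H →L[ℂ] H) (hT : IsCompactOperator T) :
    ∃ (κ : Type u) (s : κ → ℝ) (f g : κ → H), Orthonormal ℂ f ∧ Orthonormal ℂ g ∧
      (∀ i, 0 < s i) ∧ (∀ i, T (g i) = (s i : ℂ) • f i) ∧
      ∀ v, HasSum (fun i => ⟪g i, v⟫_ℂ • T (g i)) (T v) := by
  obtain ⟨κ, e, he⟩ := exists_eigenbasis T hT
  have hpos : ∀ i : {i : κ // T (e i) ≠ 0}, 0 < ‖T (e i)‖ := fun i => norm_pos_iff.2 i.2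
  refine ⟨{i : κ // T (e i) ≠ 0}, fun i => ‖T (e i)‖,
    fun i => ((‖T (e i)‖ : ℂ)⁻¹) • T (e i), fun i => e i, ⟨?_, ?_⟩,
    e.orthonormal.comp _ Subtype.val_injective, hpos, ?_, ?_⟩
  · intro i
    simp only [norm_smul, norm_inv, Complex.norm_real, norm_norm]
    exact inv_mul_cancel₀ (hpos i).ne'
  · intro i j hij
    simp only [inner_smul_left, inner_smul_right]
    rw [he _ _ (fun h => hij (Subtype.ext h)), mul_zero, mul_zero]
  · intro i
    simp only []
    rw [smul_smul, mul_inv_cancel₀, one_smul]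
    exact_mod_cast (hpos i).ne'
  · intro v
    have h4 := (e.hasSum_repr v).mapL T
    simp only [map_smul, e.repr_apply_apply] at h4
    refine (hasSum_subtype_iff_of_support_subset (s := {i | T (e i) ≠ 0}) ?_).2 h4
    intro i hi h0
    simp [h0] at hi

theorem nuclear_exists_schmidt [CompleteSpace H] {ι : Type*} {T : H →L[ℂ] H} {x y : ι → H}
    (hT : HasSum (fun i => rankOne ℂ (x i) (y i)) T) (hs : Summable fun i => ‖x i‖ * ‖y i‖) :
    ∃ (N : Set ℕ) (s : N → ℝ) (f g : N → H), IsSchmidtDecomposition T N s f g := by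
  obtain ⟨κ, s, f, g, hf, hg, hpos, hsf, hv⟩ := exists_compact_svd T (nuclear_isCompact hT)
  have hsum : Summable s := by
    refine summable_of_sum_le (fun j => (hpos j).le) (c := ∑' i, ‖x i‖ * ‖y i‖) fun F => ?_
    refine le_trans (le_of_eq (Finset.sum_congr rfl fun j _ => ?_))
      (nuclear_inner_bound hT hs hf hg F)
    rw [hsf j, inner_smul_right, inner_self_eq_norm_sq_to_K, hf.1]
    simp [abs_of_pos (hpos j)]
  have hcount : Countable κ := by
    have h := hsum.countable_support
    have h2 : Function.support s = Set.univ := Set.eq_univ_of_forall fun i => (hpos i).ne'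
    rw [h2] at h
    exact Set.countable_univ_iff.1 h
  have hop : HasSum (fun i => (s i : ℂ) • rankOne ℂ (f i) (g i)) T := by
    have h1 : Summable (fun i => (s i : ℂ) • rankOne ℂ (f i) (g i)) := by
      refine Summable.of_norm (hsum.congr fun i => ?_)
      simp [norm_smul, hf.1, hg.1, abs_of_pos (hpos i)]
    have h2 : (∑' i, (s i : ℂ) • rankOne ℂ (f i) (g i)) = T := by
      ext v
      have h3 := h1.hasSum.mapL (ContinuousLinearMap.apply ℂ H v)
      refine h3.unique ((hv v).congr_fun fun i => ?_)
      rw [hsf, smul_comm]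
      rfl
    rw [← h2]
    exact h1.hasSum
  obtain ⟨φ, hφ⟩ := Countable.exists_injective_nat κ
  let E := Equiv.ofInjective φ hφ
  have hE : HasSum (fun j => (s (E.symm j) : ℂ) • rankOne ℂ (f (E.symm j)) (g (E.symm j))) T :=
    (E.symm.hasSum_iff (f := fun i => (s i : ℂ) • rankOne ℂ (f i) (g i))).2 hop
  exact ⟨Set.range φ, fun j => s (E.symm j), fun j => f (E.symm j), fun j => g (E.symm j),
    ⟨hf.comp _ E.symm.injective, hg.comp _ E.symm.injective, fun j => hpos _, hE⟩⟩

theorem IsSchmidtDecomposition.nuclear {X : H →L[ℂ] H} {N : Set ℕ} {s : N → ℝ} {f g : N → H}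
    (h : IsSchmidtDecomposition X N s f g) :
    HasSum (fun j => rankOne ℂ ((s j : ℂ) • f j) (g j)) X ∧
      ∀ j, ‖(s j : ℂ) • f j‖ * ‖g j‖ = s j := by
  refine ⟨by simpa using h.hasSum, fun j => ?_⟩
  simp [norm_smul, h.orthonormal_left.1, h.orthonormal_right.1, abs_of_pos (h.pos j)]

theorem IsSchmidtDecomposition.traceNorm_eq {X : H →L[ℂ] H} {N : Set ℕ} {s : N → ℝ} {f g : N → H}
    (h : IsSchmidtDecomposition X N s f g) (hs : Summable s) : traceNorm X = ∑' j, s j := by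
  have key : {r : ℝ | ∃ (N : Set ℕ) (s : N → ℝ) (f g : N → H),
      IsSchmidtDecomposition X N s f g ∧ HasSum s r} = {∑' j, s j} := by
    refine Set.eq_singleton_iff_unique_mem.2 ⟨⟨N, s, f, g, h, hs.hasSum⟩, ?_⟩
    rintro r ⟨N', s', f', g', h', hs'⟩
    rw [← hs'.tsum_eq]
    have e : ∀ j, ‖(s j : ℂ) • f j‖ * ‖g j‖ = s j := h.nuclear.2
    have e' : ∀ j, ‖(s' j : ℂ) • f' j‖ * ‖g' j‖ = s' j := h'.nuclear.2
    refine le_antisymm ?_ ?_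
    · refine (nuclear_schmidt_sum_le h.nuclear.1 (hs.congr fun j => (e j).symm) h').2.trans_eq (tsum_congr e)
    · refine (nuclear_schmidt_sum_le h'.nuclear.1 (hs'.summable.congr fun j => (e' j).symm) h).2.trans_eq
        (tsum_congr e')
  rw [traceNorm, key, csInf_singleton]

theorem nuclear_isTraceClass [CompleteSpace H] {ι : Type*} {T : H →L[ℂ] H} {x y : ι → H}
    (hT : HasSum (fun i => rankOne ℂ (x i) (y i)) T) (hs : Summable fun i => ‖x i‖ * ‖y i‖) :
    IsTraceClass T ∧ traceNorm T ≤ ∑' i, ‖x i‖ * ‖y i‖ := by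
  obtain ⟨N, s, f, g, h⟩ := nuclear_exists_schmidt hT hs
  obtain ⟨h1, h2⟩ := nuclear_schmidt_sum_le hT hs h
  exact ⟨⟨N, s, f, g, h, h1⟩, (h.traceNorm_eq h1).trans_le h2⟩

theorem IsTraceClass.exists_nuclear {X : H →L[ℂ] H} (h : IsTraceClass X) :
    ∃ (N : Set ℕ) (x y : N → H), HasSum (fun i => rankOne ℂ (x i) (y i)) X ∧
      HasSum (fun i => ‖x i‖ * ‖y i‖) (traceNorm X) := by
  obtain ⟨N, s, f, g, h, hs⟩ := h
  refine ⟨N, _, g, h.nuclear.1, ?_⟩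
  rw [h.traceNorm_eq hs]
  exact hs.hasSum.congr_fun (fun j => h.nuclear.2 j)

end Nuclear

section TraceClassSpace

variable (H : Type*) [NormedAddCommGroup H] [InnerProductSpace ℂ H] [CompleteSpace H]

variable {H} in
theorem IsTraceClass.add {X Y : H →L[ℂ] H} (hX : IsTraceClass X) (hY : IsTraceClass Y) :
    IsTraceClass (X + Y) ∧ traceNorm (X + Y) ≤ traceNorm X + traceNorm Y := by
  obtain ⟨N, x, y, h1, h2⟩ := hX.exists_nuclear
  obtain ⟨M, u, v, h3, h4⟩ := hY.exists_nuclear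
  have h5 : HasSum (fun i => rankOne ℂ (Sum.elim x u i) (Sum.elim y v i)) (X + Y) :=
    HasSum.sum (f := fun i => rankOne ℂ (Sum.elim x u i) (Sum.elim y v i)) h1 h3
  have h6 : HasSum (fun i => ‖Sum.elim x u i‖ * ‖Sum.elim y v i‖) (traceNorm X + traceNorm Y) :=
    HasSum.sum (f := fun i => ‖Sum.elim x u i‖ * ‖Sum.elim y v i‖) h2 h4
  have h7 := nuclear_isTraceClass h5 h6.summable
  exact ⟨h7.1, h7.2.trans_eq h6.tsum_eq⟩

variable {H} in
theorem IsTraceClass.smul {X : H →L[ℂ] H} (hX : IsTraceClass X) (c : ℂ) :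
    IsTraceClass (c • X) ∧ traceNorm (c • X) ≤ ‖c‖ * traceNorm X := by
  obtain ⟨N, x, y, h1, h2⟩ := hX.exists_nuclear
  have h5 : HasSum (fun i => rankOne ℂ (c • x i) (y i)) (c • X) := by
    simpa using h1.const_smul c
  have h6 : HasSum (fun i => ‖c • x i‖ * ‖y i‖) (‖c‖ * traceNorm X) := by
    simpa [norm_smul, mul_assoc] using h2.mul_left ‖c‖
  have h7 := nuclear_isTraceClass h5 h6.summable
  exact ⟨h7.1, h7.2.trans_eq h6.tsum_eq⟩

variable {H} in
theorem isTraceClass_zero : IsTraceClass (0 : H →L[ℂ] H) :=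
  (nuclear_isTraceClass (ι := Empty) (x := fun _ => 0) (y := fun _ => 0)
    (by simp) (by simp)).1

variable {H} in
theorem isTraceClass_rankOne (x y : H) : IsTraceClass (rankOne ℂ x y) :=
  (nuclear_isTraceClass (ι := Unit) (x := fun _ => x) (y := fun _ => y)
    (hasSum_unique _) (hasSum_unique _).summable).1

/-- The trace-class operators on `H`, as a linear subspace of the bounded operators. -/
def traceClassSubmodule : Submodule ℂ (H →L[ℂ] H) where
  carrier := {X | IsTraceClass X}
  add_mem' hX hY := (hX.add hY).1
  zero_mem' := isTraceClass_zero
  smul_mem' c _ hX := (hX.smul c).1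

/-- The trace class of `H`; its norm is the trace norm (not the operator norm). -/
def TraceClass : Type _ := traceClassSubmodule H

noncomputable instance : AddCommGroup (TraceClass H) :=
  inferInstanceAs (AddCommGroup (traceClassSubmodule H))

noncomputable instance : Module ℂ (TraceClass H) :=
  inferInstanceAs (Module ℂ (traceClassSubmodule H))

variable {H} in
/-- A trace-class operator as an element of the space `TraceClass H`. -/
def TraceClass.mk (X : H →L[ℂ] H) (hX : IsTraceClass X) : TraceClass H := ⟨X, hX⟩

variable {H} in
/-- The underlying bounded operator. -/
noncomputable def TraceClass.toCLM : TraceClass H →ₗ[ℂ] (H →L[ℂ] H) :=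
  (traceClassSubmodule H).subtype

variable {H} in
theorem TraceClass.isTraceClass (X : TraceClass H) : IsTraceClass X.toCLM := X.2

variable {H} in
theorem TraceClass.toCLM_injective : Function.Injective (TraceClass.toCLM (H := H)) :=
  Subtype.val_injective

noncomputable instance : Norm (TraceClass H) := ⟨fun X => traceNorm X.toCLM⟩

theorem TraceClass.normCore : NormedSpace.Core ℂ (TraceClass H) where
  norm_nonneg X := by
    obtain ⟨N, x, y, h1, h2⟩ := X.isTraceClass.exists_nuclear
    exact h2.nonneg fun i => by positivity
  norm_smul c X := by
    change traceNorm (c • X).toCLM = ‖c‖ * traceNorm X.toCLM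
    rw [map_smul]
    refine le_antisymm (X.isTraceClass.smul c).2 ?_
    by_cases hc : c = 0
    · subst hc
      obtain ⟨N, x, y, h1, h2⟩ := (X.isTraceClass.smul 0).1.exists_nuclear
      rw [norm_zero, zero_mul]
      exact h2.nonneg fun i => by positivity
    · have h := ((X.isTraceClass.smul c).1.smul c⁻¹).2
      rw [smul_smul, inv_mul_cancel₀ hc, one_smul, norm_inv] at h
      rwa [← le_inv_mul_iff₀ (norm_pos_iff.2 hc)]
  norm_triangle X Y := by
    change traceNorm (X + Y).toCLM ≤ _
    rw [map_add]
    exact (X.isTraceClass.add Y.isTraceClass).2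
  norm_eq_zero_iff X := by
    obtain ⟨N, x, y, h1, h2⟩ := X.isTraceClass.exists_nuclear
    constructor
    · intro h
      change traceNorm X.toCLM = 0 at h
      rw [h, hasSum_zero_iff_of_nonneg fun i => by positivity] at h2
      apply TraceClass.toCLM_injective
      rw [map_zero]
      refine h1.unique (hasSum_zero.congr_fun fun i => ?_)
      rw [← norm_eq_zero, norm_rankOne]
      exact congrFun h2 i
    · rintro rfl
      have h := (isTraceClass_zero (H := H).smul 0).2
      rw [norm_zero, zero_mul, smul_zero] at h
      exact le_antisymm h (by
        rw [map_zero] at h2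
        exact h2.nonneg fun i => by positivity)

noncomputable instance : NormedAddCommGroup (TraceClass H) :=
  NormedAddCommGroup.ofCore (TraceClass.normCore H)

noncomputable instance : NormedSpace ℂ (TraceClass H) :=
  NormedSpace.ofCore (TraceClass.normCore H)

theorem TraceClass.norm_def (X : TraceClass H) : ‖X‖ = traceNorm X.toCLM := rfl

variable {H} in
/-- The rank-one operator `|x⟩⟨y|`, `z ↦ ⟪y, z⟫ x`, as a trace-class operator. -/
noncomputable def TraceClass.ketbra (x y : H) : TraceClass H :=
  TraceClass.mk (rankOne ℂ x y) (isTraceClass_rankOne x y)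

end TraceClassSpace

section Tensor

variable (H Z : Type*) [NormedAddCommGroup H] [InnerProductSpace ℂ H]
  [NormedAddCommGroup Z] [InnerProductSpace ℂ Z]

/-- The Hilbert space tensor product: the completion of the algebraic tensor product with respect
to `⟪x ⊗ z, x' ⊗ z'⟫ = ⟪x, x'⟫ ⟪z, z'⟫`. -/
abbrev HilbertTensor : Type _ := UniformSpace.Completion (H ⊗[ℂ] Z)

variable {H Z}

/-- The elementary tensor `x ⊗ z`. -/
noncomputable def htmul (x : H) (z : Z) : HilbertTensor H Z := ((x ⊗ₜ[ℂ] z : H ⊗[ℂ] Z) : _)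

/-- The bounded operator `A ⊗ B` on `H ⊗ Z`, determined by `(A ⊗ B)(x ⊗ z) = A x ⊗ B z`. -/
noncomputable def tensorOp (A : H →L[ℂ] H) (B : Z →L[ℂ] Z) :
    HilbertTensor H Z →L[ℂ] HilbertTensor H Z :=
  (TensorProduct.mapL A B).completion

theorem tensorOp_htmul (A : H →L[ℂ] H) (B : Z →L[ℂ] Z) (x : H) (z : Z) :
    tensorOp A B (htmul x z) = htmul (A x) (B z) := by
  simp [tensorOp, htmul]

theorem htmul_inner (x x' : H) (z z' : Z) :
    ⟪htmul x z, htmul x' z'⟫_ℂ = ⟪x, x'⟫_ℂ * ⟪z, z'⟫_ℂ := by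
  simp [htmul]

theorem htmul_norm (x : H) (z : Z) : ‖htmul x z‖ = ‖x‖ * ‖z‖ := by
  simp [htmul]

theorem hilbertTensor_ext {E : Type*} [NormedAddCommGroup E] [NormedSpace ℂ E]
    {S T : HilbertTensor H Z →L[ℂ] E} (h : ∀ x z, S (htmul x z) = T (htmul x z)) : S = T := by
  ext v
  refine UniformSpace.Completion.induction_on v (isClosed_eq S.continuous T.continuous) fun a => ?_
  induction a using TensorProduct.induction_on with
  | zero => rw [UniformSpace.Completion.coe_zero, map_zero, map_zero]
  | tmul x z => exact h x z
  | add a b ha hb => rw [UniformSpace.Completion.coe_add, map_add, map_add, ha, hb]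

/-- The elementary tensor as a continuous bilinear map. -/
noncomputable def htmulL : H →L[ℂ] Z →L[ℂ] HilbertTensor H Z :=
  (ContinuousLinearMap.compL ℂ Z (H ⊗[ℂ] Z) (HilbertTensor H Z)
    UniformSpace.Completion.toComplL) ∘L (TensorProduct.mkL ℂ H Z)

theorem IsTraceClass.tensorOp {A : H →L[ℂ] H} {B : Z →L[ℂ] Z} (hA : IsTraceClass A)
    (hB : IsTraceClass B) : IsTraceClass (tensorOp A B) := by
  obtain ⟨N, x, y, h1, h2⟩ := hA.exists_nuclear
  obtain ⟨M, u, v, h3, h4⟩ := hB.exists_nuclear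
  have hs : Summable fun i : N × M => ‖htmul (x i.1) (u i.2)‖ * ‖htmul (y i.1) (v i.2)‖ := by
    refine (h2.summable.mul_of_nonneg h4.summable (fun i => by positivity)
      (fun i => by positivity)).congr fun i => ?_
    rw [htmul_norm, htmul_norm]; ring
  have hS : Summable fun i : N × M =>
      rankOne ℂ (htmul (x i.1) (u i.2)) (htmul (y i.1) (v i.2)) :=
    Summable.of_norm (hs.congr fun i => by rw [norm_rankOne])
  have hT : (∑' i : N × M, rankOne ℂ (htmul (x i.1) (u i.2)) (htmul (y i.1) (v i.2))) =
      _root_.tensorOp A B := by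
    refine hilbertTensor_ext fun a b => ?_
    rw [tensorOp_htmul]
    have e1 := h1.mapL (ContinuousLinearMap.apply ℂ H a)
    have e2 := h3.mapL (ContinuousLinearMap.apply ℂ Z b)
    have e3 := hS.hasSum.mapL (ContinuousLinearMap.apply ℂ (HilbertTensor H Z) (htmul a b))
    have e4 : ∀ i, HasSum (fun j => rankOne ℂ (htmul (x i) (u j)) (htmul (y i) (v j)) (htmul a b))
        (htmulL (rankOne ℂ (x i) (y i) a) (B b)) := by
      intro i
      refine (e2.mapL (htmulL (rankOne ℂ (x i) (y i) a))).congr_fun fun j => ?_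
      change _ = htmulL _ (rankOne ℂ (u j) (v j) b)
      rw [rankOne_apply, rankOne_apply, rankOne_apply, htmul_inner, map_smul, map_smul,
        smul_apply, smul_smul, mul_comm]
      rfl
    have e5 := e3.prod_fiberwise e4
    have e6 := e1.mapL ((htmulL (H := H) (Z := Z)).flip (B b))
    exact e5.unique e6
  have hN : HasSum (fun i : N × M =>
      rankOne ℂ (htmul (x i.1) (u i.2)) (htmul (y i.1) (v i.2))) (_root_.tensorOp A B) :=
    hT ▸ hS.hasSum
  exact (nuclear_isTraceClass hN hs).1

variable [CompleteSpace H] [CompleteSpace Z]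

/-- `A ⊗ B` as a trace-class operator on `H ⊗ Z`. -/
noncomputable def TraceClass.tensor (A : TraceClass H) (B : TraceClass Z) :
    TraceClass (HilbertTensor H Z) :=
  TraceClass.mk (tensorOp A.toCLM B.toCLM) (A.isTraceClass.tensorOp B.isTraceClass)

end Tensor

section Choi

variable {H Z J : Type*} [NormedAddCommGroup H] [InnerProductSpace ℂ H] [CompleteSpace H]
  [NormedAddCommGroup Z] [InnerProductSpace ℂ Z] [CompleteSpace Z]

/-- The `(j, k)` summand `conj λ_j λ_k |g_j⟩⟨g_k| ⊗ Φ(|g_j⟩⟨g_k|)` of the weighted Choi operator. -/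
noncomputable def choiTerm (l : lp (fun _ : J => ℂ) 1) (g : HilbertBasis J ℂ H)
    (Φ : TraceClass H →L[ℂ] TraceClass Z) (p : J × J) : TraceClass (HilbertTensor H Z) :=
  (starRingEnd ℂ (l p.1) * l p.2) •
    (TraceClass.ketbra (g p.1) (g p.2)).tensor (Φ (TraceClass.ketbra (g p.1) (g p.2)))

/-- The weighted Choi map: the (unordered, trace-norm) sum of all the summands `choiTerm`. -/
noncomputable def choiMap (l : lp (fun _ : J => ℂ) 1) (g : HilbertBasis J ℂ H)
    (Φ : TraceClass H →L[ℂ] TraceClass Z) : TraceClass (HilbertTensor H Z) :=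
  ∑' p : J × J, choiTerm l g Φ p

end Choi

/-!
Compression to the `(g j, g k)` block sends `∑ conj λ_j λ_k |g_j⟩⟨g_k| ⊗ Φ(|g_j⟩⟨g_k|)` to
`conj λ_j λ_k Φ(|g_j⟩⟨g_k|)`. An operator on `H ⊗ Z` is determined by its blocks and a bounded map
on the trace class by its values on the `|g_j⟩⟨g_k|`, so the Choi map acts on blocks as
multiplication by `conj λ_j λ_k`; it is injective exactly when no weight vanishes, and a vanishing
weight also rules out surjectivity. In finite dimension the factors can be divided out.

In infinite dimension, the square roots of the diagonal matrix elements of an operator in the range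
are at most `|λ_j| ‖Φ‖ ^ (1/2)`, hence summable, for every orthonormal basis `g`. By Cauchy–Schwarz,
for `Y = ∑ₙ tₙ² |eₙ ⊗ z⟩⟨eₙ ⊗ z|` with `e` orthonormal this forces `∑ tₙ < ∞`, so `tₙ = 1 / (n + 1)`
gives an operator which is never in the range.
-/

section HilbertBasis

variable {𝕜 E F ι J : Type*} [RCLike 𝕜] [NormedAddCommGroup E] [InnerProductSpace 𝕜 E]

theorem dense_span_range_hilbertBasis (b : HilbertBasis J 𝕜 E) :
    Dense (Submodule.span 𝕜 (Set.range b) : Set E) :=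
  Submodule.dense_iff_topologicalClosure_eq_top.2 b.dense_span

theorem clm_ext_hilbertBasis [AddCommMonoid F] [Module 𝕜 F] [TopologicalSpace F] [T2Space F]
    {σ : 𝕜 →+* 𝕜} (b : HilbertBasis J 𝕜 E) {S T : E →SL[σ] F} (h : ∀ j, S (b j) = T (b j)) :
    S = T :=
  ContinuousLinearMap.ext_on (dense_span_range_hilbertBasis b) <| by
    rintro _ ⟨j, rfl⟩
    exact h j

theorem separableSpace_of_countable_hilbertBasis [Countable J] (b : HilbertBasis J 𝕜 E) :
    TopologicalSpace.SeparableSpace E := by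
  have h := ((Set.countable_range b).isSeparable.span (R := 𝕜)).closure
  rw [(dense_span_range_hilbertBasis b).closure_eq] at h
  exact TopologicalSpace.isSeparable_univ_iff.1 h

theorem hasSum_sq_norm_inner_hilbertBasis (b : HilbertBasis J 𝕜 E) (x : E) :
    HasSum (fun j => ‖⟪x, b j⟫_𝕜‖ ^ 2) (‖x‖ ^ 2) := by
  simpa [b.repr_apply_apply, norm_inner_symm x] using lp.hasSum_norm (by simp) (b.repr x)

theorem exists_orthonormal_nat (h : ¬ FiniteDimensional 𝕜 E) :
    ∃ e : ℕ → E, Orthonormal 𝕜 e := by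
  let b := Module.Basis.ofVectorSpace 𝕜 E
  have : Infinite (Module.Basis.ofVectorSpaceIndex 𝕜 E) :=
    not_finite_iff_infinite.1 fun _ => h (Module.Finite.of_basis b)
  exact ⟨_, InnerProductSpace.gramSchmidtNormed_orthonormal
    (b.linearIndependent.comp _ (Infinite.natEmbedding _).injective)⟩

theorem sum_mul_sq_norm_inner_le {e : ι → E} (he : Orthonormal 𝕜 e) (t : ι → ℝ) (x : E)
    (s : Finset ι) :
    ∑ i ∈ s, t i * ‖⟪e i, x⟫_𝕜‖ ^ 2 ≤ √(∑ i ∈ s, (t i * ‖⟪e i, x⟫_𝕜‖) ^ 2) * ‖x‖ :=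
  calc ∑ i ∈ s, t i * ‖⟪e i, x⟫_𝕜‖ ^ 2
      = ∑ i ∈ s, t i * ‖⟪e i, x⟫_𝕜‖ * ‖⟪e i, x⟫_𝕜‖ := Finset.sum_congr rfl fun i _ => by ring
    _ ≤ √(∑ i ∈ s, (t i * ‖⟪e i, x⟫_𝕜‖) ^ 2) * √(∑ i ∈ s, ‖⟪e i, x⟫_𝕜‖ ^ 2) :=
        Real.sum_mul_le_sqrt_mul_sqrt _ _ _
    _ ≤ √(∑ i ∈ s, (t i * ‖⟪e i, x⟫_𝕜‖) ^ 2) * ‖x‖ := by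
        gcongr
        exact Real.sqrt_le_iff.2 ⟨norm_nonneg _, he.sum_inner_products_le _⟩

-- With `D = ∑ i, t i |e i⟩⟨e i|`, this reads `tr D = ∑ j, ⟪b j, D (b j)⟫ ≤ ∑ j, ‖D (b j)‖`.
theorem summable_of_sum_sq_mul_norm_inner_le {e : ι → E} (he : Orthonormal 𝕜 e)
    (b : HilbertBasis J 𝕜 E) {t : ι → ℝ} (ht : ∀ i, 0 ≤ t i) {r : J → ℝ} (hr0 : ∀ j, 0 ≤ r j)
    (hr : Summable r)
    (h : ∀ j (s : Finset ι), ∑ i ∈ s, (t i * ‖⟪e i, b j⟫_𝕜‖) ^ 2 ≤ r j ^ 2) : Summable t := by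
  have column_le (s : Finset ι) (j : J) : ∑ i ∈ s, t i * ‖⟪e i, b j⟫_𝕜‖ ^ 2 ≤ r j :=
    (sum_mul_sq_norm_inner_le he t (b j) s).trans <| by
      rw [b.orthonormal.1, mul_one]
      exact Real.sqrt_le_iff.2 ⟨hr0 j, h j s⟩
  have hasSum_column (s : Finset ι) :
      HasSum (fun j => ∑ i ∈ s, t i * ‖⟪e i, b j⟫_𝕜‖ ^ 2) (∑ i ∈ s, t i) :=
    hasSum_sum fun i _ => by
      simpa [he.1] using (hasSum_sq_norm_inner_hilbertBasis b (e i)).mul_left (t i)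
  exact summable_of_sum_le ht fun s => hasSum_le (column_le s) (hasSum_column s) hr.hasSum

end HilbertBasis

theorem summable_norm_lp_one {ι : Type*} {E : ι → Type*} [∀ i, NormedAddCommGroup (E i)]
    (f : lp E 1) : Summable fun i => ‖f i‖ := by
  simpa using (lp.memℓp f).summable (by simp)

theorem countable_of_lp_one_ne_zero {ι : Type*} {E : ι → Type*} [∀ i, NormedAddCommGroup (E i)]
    (f : lp E 1) (hf : ∀ i, f i ≠ 0) : Countable ι := by
  have hsupp : (Function.support fun i => ‖f i‖) = Set.univ :=
    Set.eq_univ_of_forall fun i => norm_ne_zero_iff.2 (hf i)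
  exact Set.countable_univ_iff.1 (hsupp ▸ (summable_norm_lp_one f).countable_support)

section TraceClassComplete

variable {H : Type*} [NormedAddCommGroup H] [InnerProductSpace ℂ H]

theorem IsTraceClass.opNorm_le_traceNorm {X : H →L[ℂ] H} (hX : IsTraceClass X) :
    ‖X‖ ≤ traceNorm X := by
  obtain ⟨N, x, y, hsum, hnorm⟩ := hX.exists_nuclear
  exact hsum.norm_le_of_bounded hnorm fun i => (norm_rankOne _ _).le

variable [CompleteSpace H]

namespace TraceClass

/-- The inclusion of the trace class into the bounded operators, as a bounded linear map. -/
noncomputable def toCLML : TraceClass H →L[ℂ] (H →L[ℂ] H) :=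
  toCLM.mkContinuous 1 fun X => by
    rw [one_mul]
    exact X.isTraceClass.opNorm_le_traceNorm

@[simp]
theorem toCLM_mk (X : H →L[ℂ] H) (hX : IsTraceClass X) : (mk X hX).toCLM = X := rfl

@[simp]
theorem toCLM_ketbra (x y : H) : (ketbra x y).toCLM = rankOne ℂ x y := rfl

theorem norm_toCLM_le (X : TraceClass H) : ‖X.toCLM‖ ≤ ‖X‖ := X.isTraceClass.opNorm_le_traceNorm

@[simp]
theorem norm_ketbra (x y : H) : ‖ketbra x y‖ = ‖x‖ * ‖y‖ := by
  refine le_antisymm ?_ (by simpa using norm_toCLM_le (ketbra x y))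
  simpa [norm_def] using (nuclear_isTraceClass (ι := Unit) (x := fun _ => x) (y := fun _ => y)
    (hasSum_unique _) (hasSum_unique _).summable).2

instance [Nontrivial H] : Nontrivial (TraceClass H) := by
  obtain ⟨x, hx⟩ := exists_ne (0 : H)
  exact ⟨ketbra x x, 0, norm_ne_zero_iff.1 (by simpa using hx)⟩

end TraceClass

-- Concatenating nuclear decompositions of the summands gives one of the sum.
theorem isTraceClass_of_hasSum {ι : Type*} {X : ι → TraceClass H} {T : H →L[ℂ] H}
    (hT : HasSum (fun i => (X i).toCLM) T) (hX : Summable fun i => ‖X i‖) :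
    IsTraceClass T ∧ traceNorm T ≤ ∑' i, ‖X i‖ := by
  choose N x y hsum hnorm using fun i => (X i).isTraceClass.exists_nuclear
  let f (p : Σ i, N i) := ‖x p.1 p.2‖ * ‖y p.1 p.2‖
  let R (p : Σ i, N i) := rankOne ℂ (x p.1 p.2) (y p.1 p.2)
  have hf : HasSum f (∑' i, ‖X i‖) :=
    HasSum.sigma_of_hasSum hX.hasSum hnorm <|
      (summable_sigma_of_nonneg fun p => by positivity).2
        ⟨fun i => (hnorm i).summable, hX.congr fun i => (hnorm i).tsum_eq.symm⟩
  have hR : HasSum R T :=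
    HasSum.sigma_of_hasSum hT hsum <|
      Summable.of_norm (hf.summable.congr fun p => (norm_rankOne _ _).symm)
  obtain ⟨hmem, hle⟩ := nuclear_isTraceClass hR hf.summable
  exact ⟨hmem, hle.trans_eq hf.tsum_eq⟩

namespace TraceClass

theorem hasSum_of_hasSum_toCLM {ι : Type*} {X : ι → TraceClass H} {T : TraceClass H}
    (hT : HasSum (fun i => (X i).toCLM) T.toCLM) (hX : Summable fun i => ‖X i‖) : HasSum X T := by
  rw [HasSum, SummationFilter.unconditional_filter, tendsto_iff_norm_sub_tendsto_zero]
  refine squeeze_zero (fun _ => norm_nonneg _) (fun s => ?_)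
    (tendsto_tsum_compl_atTop_zero fun i => ‖X i‖)
  have hrest : HasSum (fun i : {i // i ∉ s} => (X i).toCLM) (T - ∑ i ∈ s, X i).toCLM := by
    rw [map_sub, map_sum]
    exact (s.hasSum_compl_iff (f := fun i => (X i).toCLM)).2 (by simpa using hT)
  rw [norm_sub_rev]
  exact (isTraceClass_of_hasSum hrest (hX.subtype _)).2

instance : CompleteSpace (TraceClass H) := by
  refine NormedAddCommGroup.completeSpace_of_summable_imp_tendsto fun X hX => ?_
  have hsum : Summable fun i => (X i).toCLM :=
    Summable.of_norm_bounded hX fun i => norm_toCLM_le (X i)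
  obtain ⟨hmem, -⟩ := isTraceClass_of_hasSum hsum.hasSum hX
  exact ⟨mk _ hmem, (hasSum_of_hasSum_toCLM (T := mk _ hmem) hsum.hasSum hX).tendsto_sum_nat⟩

theorem exists_hasSum_ketbra (X : TraceClass H) :
    ∃ (N : Set ℕ) (x y : N → H), HasSum (fun i => ketbra (x i) (y i)) X := by
  obtain ⟨N, x, y, hsum, hnorm⟩ := X.isTraceClass.exists_nuclear
  exact ⟨N, x, y, hasSum_of_hasSum_toCLM hsum (by simpa using hnorm.summable)⟩

end TraceClass

end TraceClassComplete

section TraceClassMaps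

variable {H K J : Type*} [NormedAddCommGroup H] [InnerProductSpace ℂ H] [CompleteSpace H]
  [NormedAddCommGroup K] [InnerProductSpace ℂ K] [CompleteSpace K]

theorem IsTraceClass.comp_comp {X : H →L[ℂ] H} (hX : IsTraceClass X) (A : H →L[ℂ] K)
    (B : K →L[ℂ] H) :
    IsTraceClass (A ∘L X ∘L B) ∧ traceNorm (A ∘L X ∘L B) ≤ ‖A‖ * ‖B‖ * traceNorm X := by
  obtain ⟨N, x, y, hsum, hnorm⟩ := hX.exists_nuclear
  have hsum' : HasSum (fun i => rankOne ℂ (A (x i)) (B.adjoint (y i))) (A ∘L X ∘L B) := by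
    simpa [comp_rankOne, rankOne_comp] using
      (hsum.mapL ((ContinuousLinearMap.compL ℂ K H H).flip B)).mapL
        (ContinuousLinearMap.compL ℂ K H K A)
  have hle (i : N) : ‖A (x i)‖ * ‖B.adjoint (y i)‖ ≤ ‖A‖ * ‖B‖ * (‖x i‖ * ‖y i‖) :=
    calc ‖A (x i)‖ * ‖B.adjoint (y i)‖
        ≤ (‖A‖ * ‖x i‖) * (‖B.adjoint‖ * ‖y i‖) := by
          gcongr <;> exact ContinuousLinearMap.le_opNorm _ _
      _ = ‖A‖ * ‖B‖ * (‖x i‖ * ‖y i‖) := by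
          rw [LinearIsometryEquiv.norm_map]
          ring
  have hbound := hnorm.mul_left (‖A‖ * ‖B‖)
  have hs := Summable.of_nonneg_of_le (fun i => by positivity) hle hbound.summable
  obtain ⟨hmem, hnorm_le⟩ := nuclear_isTraceClass hsum' hs
  exact ⟨hmem, hnorm_le.trans (hasSum_le hle hs.hasSum hbound)⟩

namespace TraceClass

/-- The compression `X ↦ A X B` of trace-class operators by bounded operators `A` and `B`. -/
noncomputable def sandwich (A : H →L[ℂ] K) (B : K →L[ℂ] H) : TraceClass H →L[ℂ] TraceClass K :=
  LinearMap.mkContinuous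
    { toFun := fun X => mk (A ∘L X.toCLM ∘L B) (X.isTraceClass.comp_comp A B).1
      map_add' := fun X Y => toCLM_injective (by simp)
      map_smul' := fun c X => toCLM_injective (by simp) }
    (‖A‖ * ‖B‖) fun X => (X.isTraceClass.comp_comp A B).2

@[simp]
theorem toCLM_sandwich (A : H →L[ℂ] K) (B : K →L[ℂ] H) (X : TraceClass H) :
    (sandwich A B X).toCLM = A ∘L X.toCLM ∘L B := rfl

theorem norm_sandwich_apply_le (A : H →L[ℂ] K) (B : K →L[ℂ] H) (X : TraceClass H) :
    ‖sandwich A B X‖ ≤ ‖A‖ * ‖B‖ * ‖X‖ := (X.isTraceClass.comp_comp A B).2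

/-- The matrix element `X ↦ ⟪a, X b⟫` as a bounded functional on the trace class. -/
noncomputable def matrixElement (a b : H) : TraceClass H →L[ℂ] ℂ :=
  innerSL ℂ a ∘L ContinuousLinearMap.apply ℂ H b ∘L toCLML

@[simp]
theorem matrixElement_apply (a b : H) (X : TraceClass H) :
    matrixElement a b X = ⟪a, X.toCLM b⟫_ℂ := rfl

theorem matrixElement_ketbra (a b x y : H) :
    matrixElement a b (ketbra x y) = ⟪y, b⟫_ℂ * ⟪a, x⟫_ℂ := by
  simp

/-- The rank-one operator `|x⟩⟨y|` as a continuous sesquilinear map into the trace class. -/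
noncomputable def ketbraL : H →L[ℂ] H →L⋆[ℂ] TraceClass H :=
  LinearMap.mkContinuous₂
    (LinearMap.mk₂'ₛₗ (RingHom.id ℂ) (starRingEnd ℂ) ketbra
      (fun _ _ _ => toCLM_injective (by simp)) (fun _ _ _ => toCLM_injective (by simp))
      (fun _ _ _ => toCLM_injective (by simp)) (fun _ _ _ => toCLM_injective (by simp)))
    1 fun x y => by simp

theorem clm_ext_ketbra {E : Type*} [NormedAddCommGroup E] [NormedSpace ℂ E]
    (g : HilbertBasis J ℂ H) {S T : TraceClass H →L[ℂ] E}
    (h : ∀ j k, S (ketbra (g j) (g k)) = T (ketbra (g j) (g k))) : S = T := by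
  have eq_left (x : H) (k : J) : S (ketbra x (g k)) = T (ketbra x (g k)) :=
    DFunLike.congr_fun (clm_ext_hilbertBasis g (S := S ∘L ketbraL.flip (g k))
      (T := T ∘L ketbraL.flip (g k)) fun j => h j k) x
  have eq_ketbra (x y : H) : S (ketbra x y) = T (ketbra x y) :=
    DFunLike.congr_fun (clm_ext_hilbertBasis g (S := S.comp (ketbraL x))
      (T := T.comp (ketbraL x)) fun k => eq_left x k) y
  ext X
  obtain ⟨N, x, y, hX⟩ := X.exists_hasSum_ketbra
  exact (hX.mapL S).unique ((hX.mapL T).congr_fun fun i => eq_ketbra _ _)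

theorem exists_clm_ketbra_eq [Finite J] {E : Type*} [NormedAddCommGroup E] [NormedSpace ℂ E]
    {g : J → H} (hg : Orthonormal ℂ g) (M : J → J → E) :
    ∃ Φ : TraceClass H →L[ℂ] E, ∀ j k, Φ (ketbra (g j) (g k)) = M j k := by
  classical
  have := Fintype.ofFinite J
  refine ⟨∑ a, ∑ b, (matrixElement (g a) (g b)).smulRight (M a b), fun j k => ?_⟩
  simp only [sum_apply, ContinuousLinearMap.smulRight_apply, matrixElement_ketbra,
    orthonormal_iff_ite.1 hg, ite_mul, one_mul, zero_mul, ite_smul, one_smul, zero_smul,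
    Finset.sum_ite_eq, Finset.sum_ite_eq', Finset.mem_univ, if_true]

end TraceClass

end TraceClassMaps

section FrameOperator

variable {H ι : Type*} [NormedAddCommGroup H] [InnerProductSpace ℂ H] [CompleteSpace H]
  {v : ι → H}

namespace TraceClass

/-- The frame operator `∑ i, |v i⟩⟨v i|` of a square-summable family of vectors. The sum is taken in
trace norm, so this is `0` if the family is not summable there. -/
noncomputable def frameOperator (v : ι → H) : TraceClass H := ∑' i, ketbra (v i) (v i)

theorem hasSum_frameOperator (hv : Summable fun i => ‖v i‖ ^ 2) :
    HasSum (fun i => ketbra (v i) (v i)) (frameOperator v) :=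
  (Summable.of_norm (hv.congr fun i => by simp [sq])).hasSum

theorem isPositive_frameOperator (hv : Summable fun i => ‖v i‖ ^ 2) :
    (frameOperator v).toCLM.IsPositive := by
  rw [← ContinuousLinearMap.nonneg_iff_isPositive]
  refine ((hasSum_frameOperator hv).mapL toCLML).nonneg fun i => ?_
  exact (ContinuousLinearMap.nonneg_iff_isPositive _).2 (isPositive_rankOne_self _)

theorem hasSum_sq_norm_inner_frameOperator (hv : Summable fun i => ‖v i‖ ^ 2) (w : H) :
    HasSum (fun i => ‖⟪v i, w⟫_ℂ‖ ^ 2) (RCLike.re ⟪w, (frameOperator v).toCLM w⟫_ℂ) := by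
  refine (((hasSum_frameOperator hv).mapL (matrixElement w w)).mapL RCLike.reCLM).congr_fun
    fun i => ?_
  rw [matrixElement_ketbra, RCLike.reCLM_apply, ← inner_conj_symm w, RCLike.mul_conj]
  norm_cast

end TraceClass

end FrameOperator

section HilbertTensor

variable {H Z J : Type*} [NormedAddCommGroup H] [InnerProductSpace ℂ H]
  [NormedAddCommGroup Z] [InnerProductSpace ℂ Z]

@[simp]
theorem htmulL_apply (x : H) (z : Z) : htmulL x z = htmul x z := rfl

theorem htmul_smul_left (c : ℂ) (x : H) (z : Z) : htmul (c • x) z = c • htmul x z :=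
  DFunLike.congr_fun (htmulL.map_smul c x) z

theorem norm_htmulL_apply_le (x : H) : ‖(htmulL x : Z →L[ℂ] HilbertTensor H Z)‖ ≤ ‖x‖ :=
  ContinuousLinearMap.opNorm_le_bound _ (norm_nonneg x) fun z => (htmul_norm x z).le

theorem summable_sq_norm_htmul_smul {ι : Type*} {e : ι → H} (he : Orthonormal ℂ e) {t : ι → ℝ}
    (ht : Summable fun i => t i ^ 2) (z : Z) :
    Summable fun i => ‖htmul ((t i : ℂ) • e i) z‖ ^ 2 := by
  simpa [htmul_norm, norm_smul, he.1, mul_pow] using ht.mul_right (‖z‖ ^ 2)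

theorem hilbertTensor_ext_basis {E : Type*} [NormedAddCommGroup E] [NormedSpace ℂ E]
    (g : HilbertBasis J ℂ H) {S T : HilbertTensor H Z →L[ℂ] E}
    (h : ∀ j z, S (htmul (g j) z) = T (htmul (g j) z)) : S = T :=
  hilbertTensor_ext fun x z =>
    DFunLike.congr_fun (clm_ext_hilbertBasis g (S := S ∘L htmulL.flip z)
      (T := T ∘L htmulL.flip z) fun j => h j z) x

theorem eq_of_inner_htmul_basis_eq (g : HilbertBasis J ℂ H) {v w : HilbertTensor H Z}
    (h : ∀ j z, ⟪v, htmul (g j) z⟫_ℂ = ⟪w, htmul (g j) z⟫_ℂ) : v = w :=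
  ext_inner_right ℂ <| DFunLike.congr_fun <|
    hilbertTensor_ext_basis g (S := innerSL ℂ v) (T := innerSL ℂ w) h

variable [CompleteSpace Z]

@[simp]
theorem adjoint_htmulL_htmul (x y : H) (z : Z) :
    (htmulL x).adjoint (htmul y z) = ⟪x, y⟫_ℂ • z :=
  ext_inner_left ℂ fun a => by
    rw [ContinuousLinearMap.adjoint_inner_right, htmulL_apply, htmul_inner, inner_smul_right]

namespace TraceClass

/-- The block `(⟨x| ⊗ 1) Y (|y⟩ ⊗ 1)` of an operator `Y` on `H ⊗ Z`, an operator on `Z`. -/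
noncomputable def block (x y : H) : TraceClass (HilbertTensor H Z) →L[ℂ] TraceClass Z :=
  sandwich (htmulL x).adjoint (htmulL y)

theorem inner_block_apply (x y : H) (Y : TraceClass (HilbertTensor H Z)) (a b : Z) :
    ⟪a, (block x y Y).toCLM b⟫_ℂ = ⟪htmul x a, Y.toCLM (htmul y b)⟫_ℂ := by
  simp [block, ContinuousLinearMap.adjoint_inner_right]

theorem ext_block (g : HilbertBasis J ℂ H) {X Y : TraceClass (HilbertTensor H Z)}
    (h : ∀ j k, block (g j) (g k) X = block (g j) (g k) Y) : X = Y :=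
  toCLM_injective <| hilbertTensor_ext_basis g fun k b => eq_of_inner_htmul_basis_eq g fun j a => by
    rw [← inner_conj_symm, ← inner_block_apply, h, inner_block_apply, inner_conj_symm]

variable [CompleteSpace H]

@[simp]
theorem toCLM_tensor (A : TraceClass H) (B : TraceClass Z) :
    (A.tensor B).toCLM = tensorOp A.toCLM B.toCLM := rfl

theorem ketbra_tensor (x y : H) (B : TraceClass Z) :
    (ketbra x y).tensor B = sandwich (htmulL x) (htmulL y).adjoint B :=
  toCLM_injective <| hilbertTensor_ext fun a b => by
    simp [tensorOp_htmul, htmul_smul_left]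

theorem norm_ketbra_tensor_le (x y : H) (B : TraceClass Z) :
    ‖(ketbra x y).tensor B‖ ≤ ‖x‖ * ‖y‖ * ‖B‖ := by
  rw [ketbra_tensor]
  refine (norm_sandwich_apply_le _ _ _).trans ?_
  rw [LinearIsometryEquiv.norm_map]
  gcongr <;> exact norm_htmulL_apply_le _

theorem block_ketbra_tensor (x y u v : H) (B : TraceClass Z) :
    block x y ((ketbra u v).tensor B) = (⟪v, y⟫_ℂ * ⟪x, u⟫_ℂ) • B :=
  toCLM_injective <| by
    ext b
    simp [block, tensorOp_htmul, htmul_smul_left, smul_smul]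

end TraceClass

end HilbertTensor

section ChoiMap

open TraceClass

variable {H Z J : Type*} [NormedAddCommGroup H] [InnerProductSpace ℂ H] [CompleteSpace H]
  [NormedAddCommGroup Z] [InnerProductSpace ℂ Z] [CompleteSpace Z]
  (l : lp (fun _ : J => ℂ) 1) (g : HilbertBasis J ℂ H)

theorem norm_apply_ketbra_hilbertBasis_le (Φ : TraceClass H →L[ℂ] TraceClass Z) (j k : J) :
    ‖Φ (ketbra (g j) (g k))‖ ≤ ‖Φ‖ := by
  simpa [g.orthonormal.1] using Φ.le_opNorm (ketbra (g j) (g k))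

theorem summable_choiTerm (Φ : TraceClass H →L[ℂ] TraceClass Z) : Summable (choiTerm l g Φ) := by
  have hl := summable_norm_lp_one l
  refine Summable.of_norm_bounded (g := fun p : J × J => ‖l p.1‖ * ‖l p.2‖ * ‖Φ‖)
    ((hl.mul_of_nonneg hl (fun _ => norm_nonneg _) fun _ => norm_nonneg _).mul_right _) fun p => ?_
  rw [choiTerm, norm_smul, norm_mul, RCLike.norm_conj]
  gcongr
  calc ‖(ketbra (g p.1) (g p.2)).tensor (Φ (ketbra (g p.1) (g p.2)))‖
      ≤ ‖g p.1‖ * ‖g p.2‖ * ‖Φ (ketbra (g p.1) (g p.2))‖ := norm_ketbra_tensor_le _ _ _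
    _ ≤ ‖Φ‖ := by
      simpa [g.orthonormal.1] using norm_apply_ketbra_hilbertBasis_le g Φ p.1 p.2

theorem block_choiMap (Φ : TraceClass H →L[ℂ] TraceClass Z) (j k : J) :
    block (g j) (g k) (choiMap l g Φ) =
      (starRingEnd ℂ (l j) * l k) • Φ (ketbra (g j) (g k)) := by
  classical
  refine ((summable_choiTerm l g Φ).hasSum.mapL (block (g j) (g k))).unique
    ((hasSum_ite_eq (j, k) _).congr_fun fun ⟨a, b⟩ => ?_)
  rw [choiTerm, map_smul, block_ketbra_tensor, orthonormal_iff_ite.1 g.orthonormal,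
    orthonormal_iff_ite.1 g.orthonormal]
  rcases eq_or_ne a j with rfl | ha
  · rcases eq_or_ne b k with rfl | hb
    · simp
    · simp [hb]
  · simp [ha, ha.symm]

theorem choiMap_eq_iff {Φ : TraceClass H →L[ℂ] TraceClass Z}
    {Y : TraceClass (HilbertTensor H Z)} :
    choiMap l g Φ = Y ↔ ∀ j k,
      (starRingEnd ℂ (l j) * l k) • Φ (ketbra (g j) (g k)) = block (g j) (g k) Y := by
  simp_rw [← block_choiMap l g Φ]
  exact ⟨fun h j k => h ▸ rfl, ext_block g⟩

variable {l} in
theorem conj_mul_ne_zero_of_forall_ne_zero (hl : ∀ j, l j ≠ 0) (j k : J) :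
    starRingEnd ℂ (l j) * l k ≠ 0 :=
  mul_ne_zero ((map_ne_zero _).2 (hl j)) (hl k)

theorem ne_zero_of_choiMap_injective [Nontrivial Z]
    (h : Function.Injective (choiMap (Z := Z) l g)) (j : J) : l j ≠ 0 := by
  intro hj
  obtain ⟨B, hB⟩ := exists_ne (0 : TraceClass Z)
  let Φ := (matrixElement (g j) (g j)).smulRight B
  have hΦ : choiMap l g Φ = choiMap l g 0 := by
    refine (choiMap_eq_iff l g).2 fun a b => ?_
    rw [block_choiMap, ContinuousLinearMap.smulRight_apply, matrixElement_ketbra]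
    rcases eq_or_ne j a with rfl | ha
    · simp [hj]
    · simp [g.orthonormal.2 ha]
  have hΦB : Φ (ketbra (g j) (g j)) = B := by
    simp [Φ, g.orthonormal.1]
  exact hB (by rw [← hΦB, h hΦ, zero_apply])

theorem choiMap_injective_iff [Nontrivial Z] :
    Function.Injective (choiMap (Z := Z) l g) ↔ ∀ j, l j ≠ 0 := by
  refine ⟨ne_zero_of_choiMap_injective l g, fun hl Φ Ψ h => clm_ext_ketbra g fun j k => ?_⟩
  have hblock := congrArg (block (g j) (g k)) h
  rw [block_choiMap, block_choiMap] at hblock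
  exact smul_right_injective _ (conj_mul_ne_zero_of_forall_ne_zero hl j k) hblock

theorem ne_zero_of_choiMap_surjective [Nontrivial Z]
    (h : Function.Surjective (choiMap (Z := Z) l g)) (j : J) : l j ≠ 0 := by
  intro hj
  obtain ⟨B, hB⟩ := exists_ne (0 : TraceClass Z)
  obtain ⟨Φ, hΦ⟩ := h ((ketbra (g j) (g j)).tensor B)
  have hblock := (choiMap_eq_iff l g).1 hΦ j j
  rw [block_ketbra_tensor] at hblock
  exact hB (by simpa [hj, g.orthonormal.1] using hblock.symm)

theorem choiMap_surjective [FiniteDimensional ℂ H] (hl : ∀ j, l j ≠ 0) :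
    Function.Surjective (choiMap (Z := Z) l g) := by
  intro Y
  have : Finite J := g.orthonormal.linearIndependent.finite
  obtain ⟨Φ, hΦ⟩ := exists_clm_ketbra_eq g.orthonormal fun j k =>
    (starRingEnd ℂ (l j) * l k)⁻¹ • block (g j) (g k) Y
  refine ⟨Φ, (choiMap_eq_iff l g).2 fun j k => ?_⟩
  rw [hΦ, smul_inv_smul₀ (conj_mul_ne_zero_of_forall_ne_zero hl j k)]

theorem re_inner_choiMap_le (Φ : TraceClass H →L[ℂ] TraceClass Z) (j : J) (z : Z) :
    RCLike.re ⟪htmul (g j) z, (choiMap l g Φ).toCLM (htmul (g j) z)⟫_ℂ ≤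
      ‖l j‖ ^ 2 * ‖Φ‖ * ‖z‖ ^ 2 := by
  set B := Φ (ketbra (g j) (g j))
  have hB : ‖B.toCLM‖ ≤ ‖Φ‖ :=
    (norm_toCLM_le B).trans (norm_apply_ketbra_hilbertBasis_le g Φ j j)
  calc RCLike.re ⟪htmul (g j) z, (choiMap l g Φ).toCLM (htmul (g j) z)⟫_ℂ
      ≤ ‖⟪htmul (g j) z, (choiMap l g Φ).toCLM (htmul (g j) z)⟫_ℂ‖ := RCLike.re_le_norm _
    _ = ‖l j‖ ^ 2 * ‖⟪z, B.toCLM z⟫_ℂ‖ := by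
        rw [← inner_block_apply, block_choiMap, map_smul, smul_apply, inner_smul_right, norm_mul,
          norm_mul, RCLike.norm_conj, sq]
    _ ≤ ‖l j‖ ^ 2 * (‖z‖ * (‖Φ‖ * ‖z‖)) := by
        gcongr
        refine (norm_inner_le_norm _ _).trans ?_
        gcongr
        exact B.toCLM.le_of_opNorm_le hB z
    _ = ‖l j‖ ^ 2 * ‖Φ‖ * ‖z‖ ^ 2 := by ring

variable {l g} in
theorem summable_of_choiMap_eq_frameOperator {ι : Type*} {e : ι → H} (he : Orthonormal ℂ e)
    {t : ι → ℝ} (ht0 : ∀ i, 0 ≤ t i) (ht : Summable fun i => t i ^ 2) {z : Z} (hz : z ≠ 0)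
    {Φ : TraceClass H →L[ℂ] TraceClass Z}
    (hΦ : choiMap l g Φ = frameOperator fun i => htmul ((t i : ℂ) • e i) z) : Summable t := by
  have norm_inner_htmul (i : ι) (x : H) :
      ‖⟪htmul ((t i : ℂ) • e i) z, htmul x z⟫_ℂ‖ = t i * ‖⟪e i, x⟫_ℂ‖ * ‖z‖ ^ 2 := by
    simp [htmul_inner, abs_of_nonneg (ht0 i), sq]
  refine summable_of_sum_sq_mul_norm_inner_le he g ht0 (r := fun j => ‖l j‖ * (√‖Φ‖ / ‖z‖))
    (fun j => by positivity) ((summable_norm_lp_one l).mul_right _) fun j s => ?_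
  have : 0 < ‖z‖ := norm_pos_iff.2 hz
  have hsum :
      (∑ i ∈ s, (t i * ‖⟪e i, g j⟫_ℂ‖) ^ 2) * (‖z‖ ^ 2) ^ 2 ≤ ‖l j‖ ^ 2 * ‖Φ‖ * ‖z‖ ^ 2 := by
    simp_rw [Finset.sum_mul, ← mul_pow, ← norm_inner_htmul]
    exact (sum_le_hasSum s (fun i _ => by positivity)
      (hasSum_sq_norm_inner_frameOperator (summable_sq_norm_htmul_smul he ht z) _)).trans
        (hΦ ▸ re_inner_choiMap_le l g Φ j z)
  calc ∑ i ∈ s, (t i * ‖⟪e i, g j⟫_ℂ‖) ^ 2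
      ≤ ‖l j‖ ^ 2 * ‖Φ‖ * ‖z‖ ^ 2 / (‖z‖ ^ 2) ^ 2 := (le_div_iff₀ (by positivity)).2 hsum
    _ = (‖l j‖ * (√‖Φ‖ / ‖z‖)) ^ 2 := by
        rw [mul_pow, div_pow, Real.sq_sqrt (norm_nonneg Φ)]
        field_simp

theorem exists_isPositive_forall_choiMap_ne [Nontrivial Z] (hH : ¬ FiniteDimensional ℂ H) :
    ∃ Y : TraceClass (HilbertTensor H Z), Y.toCLM.IsPositive ∧
      ∀ (J : Type*) (g : HilbertBasis J ℂ H) (l : lp (fun _ : J => ℂ) 1)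
        (Φ : TraceClass H →L[ℂ] TraceClass Z), choiMap l g Φ ≠ Y := by
  obtain ⟨e, he⟩ := exists_orthonormal_nat hH
  obtain ⟨z, hz⟩ := exists_ne (0 : Z)
  let t (n : ℕ) : ℝ := 1 / (n + 1)
  have ht : Summable fun n => t n ^ 2 := by
    simpa [t] using (summable_nat_add_iff 1).2 (Real.summable_one_div_nat_pow.2 one_lt_two)
  have ht' : ¬ Summable t := by
    simpa [t] using mt (summable_nat_add_iff 1).1 Real.not_summable_one_div_natCast
  refine ⟨frameOperator fun n => htmul ((t n : ℂ) • e n) z, isPositive_frameOperator ?_,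
    fun J g l Φ hΦ => ht' ?_⟩
  · exact summable_sq_norm_htmul_smul he ht z
  · exact summable_of_choiMap_eq_frameOperator he (fun n => by positivity) ht hz hΦ

theorem choiMap_surjective_iff [Nontrivial Z] :
    Function.Surjective (choiMap (Z := Z) l g) ↔ FiniteDimensional ℂ H ∧ ∀ j, l j ≠ 0 := by
  refine ⟨fun h => ⟨by_contra fun hH => ?_, ne_zero_of_choiMap_surjective l g h⟩,
    fun ⟨_, hl⟩ => choiMap_surjective l g hl⟩
  obtain ⟨Y, -, hY⟩ := exists_isPositive_forall_choiMap_ne (Z := Z) hH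
  obtain ⟨Φ, hΦ⟩ := h Y
  exact hY J g l Φ hΦ

end ChoiMap

theorem proposition1 (H Z : Type*)
    [NormedAddCommGroup H] [InnerProductSpace ℂ H] [CompleteSpace H]
    [NormedAddCommGroup Z] [InnerProductSpace ℂ Z] [CompleteSpace Z] [Nontrivial Z] :
    (∀ (J : Type*) (g : HilbertBasis J ℂ H) (l : lp (fun _ : J => ℂ) 1),
      (∀ Φ : TraceClass H →L[ℂ] TraceClass Z, Summable (choiTerm l g Φ)) ∧
      (Function.Injective (choiMap (Z := Z) l g) ↔
        TopologicalSpace.SeparableSpace H ∧ ∀ j, l j ≠ 0) ∧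
      (Function.Surjective (choiMap (Z := Z) l g) ↔
        FiniteDimensional ℂ H ∧ ∀ j, l j ≠ 0)) ∧
    (¬ FiniteDimensional ℂ H →
      ∃ Y : TraceClass (HilbertTensor H Z), Y.toCLM.IsPositive ∧
        ∀ (J : Type*) (g : HilbertBasis J ℂ H) (l : lp (fun _ : J => ℂ) 1),
          choiMap (Z := Z) l g ⁻¹' {Y} = ∅) := by
  refine ⟨fun J g l => ⟨summable_choiTerm l g, ?_, choiMap_surjective_iff l g⟩, fun hH => ?_⟩
  · rw [choiMap_injective_iff]
    refine ⟨fun hl => ⟨?_, hl⟩, And.right⟩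
    have := countable_of_lp_one_ne_zero l hl
    exact separableSpace_of_countable_hilbertBasis g
  · obtain ⟨Y, hpos, hY⟩ := exists_isPositive_forall_choiMap_ne (Z := Z) hH
    exact ⟨Y, hpos, fun J g l => Set.eq_empty_of_forall_notMem (hY J g l)⟩
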